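/- Let $\mathcal H$ be a (real or complex) Hilbert space with inner product $\langle\cdot,\cdot\rangle$ linear in the first variable, let $I$ be a countable index set, and let $\Psi=\{\psi_i\}_{i\in I}$ be a family of vectors in $\mathcal H$. Let $C_\Psi$ be its analysis operator, $C_\Psi f=\{\langle f,\psi_i\rangle\}_{i\in I}$, with domain $\operatorname{dom}(C_\Psi)=\{f\in\mathcal H:\{\langle f,\psi_i\rangle\}_{i\in I}\in\ell^2(I)\}$ (not assumed to be dense). The sequence $\Psi$ is called - a *lower frame sequence* if there is $A>0$ with $\sqrt A\,\|f\|\le\|C_\Psi f\|$ for all $f\in\operatorname{dom}(C_\Psi)$; - *exact* if $\overline{\operatorname{span}}\{\psi_i\}_{i\in I}\neq\overline{\operatorname{span}}\{\psi_i\}_{i\in I,\,i\ne k}$ for every $k\in I$; - *minimal* if $\psi_j\notin\overline{\operatorname{span}}\{\psi_i\}_{i\in I,\,i\neq j}$ for every $j\in I$. A sequence $\Phi=\{\phi_i\}_{i\in I}$ in $\mathcal H$ is *biorthogonal* to $\Psi$ if $\langle\psi_i,\phi_j\rangle=\delta_{ij}$ for all $i,j\in I$. Let $\mathcal H_\Psi=\overline{\operatorname{dom}(C_\Psi)}$,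 let $\pi$ be the orthogonal projection of $\mathcal H$ onto $\mathcal H_\Psi$, let $C_\Psi^r:\operatorname{dom}(C_\Psi)\subseteq\mathcal H_\Psi\to\ell^2(I)$ be $C_\Psi$ regarded as a densely defined operator on $\mathcal H_\Psi$ (equivalently, the analysis operator of $\{\pi\psi_i\}_{i\in I}$ in $\mathcal H_\Psi$), and let $\Gamma_\Psi=(C_\Psi^r)^*C_\Psi^r$, an operator in $\mathcal H_\Psi$ with domain $\{f\in\operatorname{dom}(C_\Psi):C_\Psi^rf\in\operatorname{dom}((C_\Psi^r)^*)\}$. When $\Gamma_\Psi$ is a bijection from its domain onto $\mathcal H_\Psi$, the *canonical dual* of $\Psi$ is the sequence $\widetilde\Psi=\{\Gamma_\Psi^{-1}\pi\psi_i\}_{i\in I}$. **Statement.** Let $\Psi$ be an exact lower frame sequence in $\mathcal H$. Then $\Gamma_\Psi$ is a bijection from its domain onto $\mathcal H_\Psi$ (so that the canonical dual $\widetilde\Psi$ is well defined), $\widetilde\Psi$ is biorthogonal to $\Psi$, every sequence in $\mathcal H$ that is biorthogonal to $\Psi$ equals $\widetilde\Psi$, and $\Psi$ is minimal. -/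

import Mathlib

noncomputable section

namespace FrameSeq

open scoped LinearPMap

/-- The product `S T` of unbounded operators, on its maximal domain
`{x ∈ dom T : T x ∈ dom S}`. -/
def opComp {𝕜 E F G : Type*} [Ring 𝕜] [AddCommGroup E] [Module 𝕜 E] [AddCommGroup F] [Module 𝕜 F]
    [AddCommGroup G] [Module 𝕜 G] (S : F →ₗ.[𝕜] G) (T : E →ₗ.[𝕜] F) : E →ₗ.[𝕜] G where
  domain := (S.domain.comap T.toFun).map T.domain.subtype
  toFun :=
    { toFun := fun x => S ⟨T ⟨x, by
          obtain ⟨y, _, hy⟩ := x.2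
          exact hy ▸ y.2⟩, by
        obtain ⟨_, y, hy, rfl⟩ := x
        exact hy⟩
      map_add' := fun x y => by
        rw [← LinearPMap.map_add]
        congr 1
        ext
        exact LinearPMap.map_add T ⟨x, _⟩ ⟨y, _⟩
      map_smul' := fun c x => by
        rw [RingHom.id_apply, ← LinearPMap.map_smul]
        congr 1
        ext
        exact LinearPMap.map_smul T c ⟨x, _⟩ }

theorem mem_opComp_domain {𝕜 E F G : Type*} [Ring 𝕜] [AddCommGroup E] [Module 𝕜 E]
    [AddCommGroup F] [Module 𝕜 F] [AddCommGroup G] [Module 𝕜 G] (S : F →ₗ.[𝕜] G)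
    (T : E →ₗ.[𝕜] F) (x : E) :
    x ∈ (opComp S T).domain ↔ ∃ h : x ∈ T.domain, T ⟨x, h⟩ ∈ S.domain := by
  constructor
  · rintro ⟨y, hy, rfl⟩
    exact ⟨y.2, hy⟩
  · rintro ⟨h, hx⟩
    exact ⟨⟨x, h⟩, hx, rfl⟩

theorem opComp_apply {𝕜 E F G : Type*} [Ring 𝕜] [AddCommGroup E] [Module 𝕜 E]
    [AddCommGroup F] [Module 𝕜 F] [AddCommGroup G] [Module 𝕜 G] (S : F →ₗ.[𝕜] G)
    (T : E →ₗ.[𝕜] F) (x : (opComp S T).domain) (h : (x : E) ∈ T.domain)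
    (h' : T ⟨x, h⟩ ∈ S.domain) : opComp S T x = S ⟨T ⟨x, h⟩, h'⟩ :=
  rfl

variable (𝕜 : Type*) {H I : Type*} [RCLike 𝕜] [NormedAddCommGroup H] [InnerProductSpace 𝕜 H]

/-- The analysis operator `C f = (⟨f, ψ_i⟩)_i` from `H` to `ℓ²(I)`, with domain
`{f : (⟨f, ψ_i⟩)_i ∈ ℓ²(I)}`. Mathlib's inner product is linear in its second entry, so
`⟨f, ψ_i⟩` is written `inner 𝕜 (ψ i) f`. -/
def analysisOp (ψ : I → H) : H →ₗ.[𝕜] lp (fun _ : I => 𝕜) 2 where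
  domain :=
    { carrier := {f | Memℓp (fun i => inner 𝕜 (ψ i) f) 2}
      zero_mem' := by
        have h : (fun i => inner 𝕜 (ψ i) (0 : H)) = 0 := by
          funext i
          simp
        change Memℓp (fun i => inner 𝕜 (ψ i) (0 : H)) 2
        rw [h]
        exact zero_memℓp
      add_mem' := fun {f g} hf hg => by
        have h : (fun i => inner 𝕜 (ψ i) (f + g)) =
            (fun i => inner 𝕜 (ψ i) f) + fun i => inner 𝕜 (ψ i) g := by
          funext i
          simp [inner_add_right]
        change Memℓp (fun i => inner 𝕜 (ψ i) (f + g)) 2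
        rw [h]
        exact Memℓp.add hf hg
      smul_mem' := fun c f hf => by
        have h : (fun i => inner 𝕜 (ψ i) (c • f)) = c • fun i => inner 𝕜 (ψ i) f := by
          funext i
          simp [inner_smul_right]
        change Memℓp (fun i => inner 𝕜 (ψ i) (c • f)) 2
        rw [h]
        exact Memℓp.const_smul hf c }
  toFun :=
    { toFun := fun f => ⟨fun i => inner 𝕜 (ψ i) (f : H), f.2⟩
      map_add' := fun f g => by
        ext i
        exact inner_add_right _ _ _
      map_smul' := fun c f => by
        ext i
        exact inner_smul_right _ _ _ }

/-- `ψ` is a lower frame sequence: `√A ‖f‖ ≤ ‖C f‖` on the domain of the analysis operator `C`,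
for some `A > 0`. -/
def IsLowerFrameSeq (ψ : I → H) : Prop :=
  ∃ A : ℝ, 0 < A ∧ ∀ f : (analysisOp 𝕜 ψ).domain, √A * ‖(f : H)‖ ≤ ‖analysisOp 𝕜 ψ f‖

/-- `ψ` is exact: leaving out any one element changes the closed linear span. -/
def IsExactSeq (ψ : I → H) : Prop :=
  ∀ k : I, (Submodule.span 𝕜 (Set.range ψ)).topologicalClosure ≠
    (Submodule.span 𝕜 (ψ '' {i | i ≠ k})).topologicalClosure

/-- `ψ` is minimal: no element lies in the closed linear span of the others. -/
def IsMinimalSeq (ψ : I → H) : Prop :=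
  ∀ j : I, ψ j ∉ (Submodule.span 𝕜 (ψ '' {i | i ≠ j})).topologicalClosure

open Classical in
/-- `φ` is biorthogonal to `ψ`: `⟨ψ_i, φ_j⟩ = δ_{ij}`. -/
def IsBiorthogonal (ψ φ : I → H) : Prop :=
  ∀ i j : I, inner 𝕜 (φ j) (ψ i) = if i = j then (1 : 𝕜) else 0

/-- The Hilbert space `H_ψ`, the closure of the domain of the analysis operator. -/
abbrev domClosure (ψ : I → H) : Submodule 𝕜 H :=
  (analysisOp 𝕜 ψ).domain.topologicalClosure

variable [CompleteSpace H]

/-- The projected sequence `(π ψ_i)_i` in `H_ψ`, where `π` is the orthogonal projection of `H`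
onto `H_ψ`. -/
def projSeq (ψ : I → H) : I → domClosure 𝕜 ψ :=
  fun i => (domClosure 𝕜 ψ).orthogonalProjectionOnto (ψ i)

/-- The restricted analysis operator `C^r`: the analysis operator of `(π ψ_i)_i` in `H_ψ`.
It is the analysis operator of `ψ`, regarded as a densely defined operator on `H_ψ`. -/
def restrictedAnalysisOp (ψ : I → H) : domClosure 𝕜 ψ →ₗ.[𝕜] lp (fun _ : I => 𝕜) 2 :=
  analysisOp 𝕜 (projSeq 𝕜 ψ)

theorem restrictedAnalysisOp_aux (ψ : I → H) (f : domClosure 𝕜 ψ) (i : I) :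
    inner 𝕜 (projSeq 𝕜 ψ i) f = inner 𝕜 (ψ i) (f : H) :=
  Submodule.inner_orthogonalProjectionOnto_eq_of_mem_right f (ψ i)

theorem mem_restrictedAnalysisOp_domain (ψ : I → H) (f : domClosure 𝕜 ψ) :
    f ∈ (restrictedAnalysisOp 𝕜 ψ).domain ↔ (f : H) ∈ (analysisOp 𝕜 ψ).domain := by
  change Memℓp (fun i => inner 𝕜 (projSeq 𝕜 ψ i) f) 2 ↔ Memℓp (fun i => inner 𝕜 (ψ i) (f : H)) 2
  simp only [restrictedAnalysisOp_aux]

/-- So the adjoint of `C^r` is a genuine one, not a default value. -/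
theorem dense_restrictedAnalysisOp_domain (ψ : I → H) :
    Dense ((restrictedAnalysisOp 𝕜 ψ).domain : Set (domClosure 𝕜 ψ)) := by
  intro f
  rw [Topology.IsInducing.subtypeVal.closure_eq_preimage_closure_image, Set.mem_preimage]
  have h : Subtype.val '' ((restrictedAnalysisOp 𝕜 ψ).domain : Set (domClosure 𝕜 ψ)) =
      ((analysisOp 𝕜 ψ).domain : Set H) := by
    ext x
    constructor
    · rintro ⟨y, hy, rfl⟩
      exact (mem_restrictedAnalysisOp_domain 𝕜 ψ y).1 hy
    · intro hx
      exact ⟨⟨x, Submodule.le_topologicalClosure _ hx⟩,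
        (mem_restrictedAnalysisOp_domain 𝕜 ψ _).2 hx, rfl⟩
  exact closure_mono h.ge f.2

/-- The generalized frame operator `Γ = (C^r)* C^r` on `H_ψ`. -/
def genFrameOp (ψ : I → H) : domClosure 𝕜 ψ →ₗ.[𝕜] domClosure 𝕜 ψ :=
  opComp (restrictedAnalysisOp 𝕜 ψ)† (restrictedAnalysisOp 𝕜 ψ)

/-- The inverse `Γ⁻¹ : H_ψ → dom Γ`. It is meaningful when `Γ : dom Γ → H_ψ` is bijective. -/
def genFrameOpInv (ψ : I → H) : domClosure 𝕜 ψ → (genFrameOp 𝕜 ψ).domain :=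
  Function.invFun (genFrameOp 𝕜 ψ).toFun

/-- The canonical dual `(Γ⁻¹ π ψ_i)_i`, as a sequence in `H`. -/
def canonicalDual (ψ : I → H) : I → H :=
  fun i => ((genFrameOpInv 𝕜 ψ (projSeq 𝕜 ψ i) : domClosure 𝕜 ψ) : H)

end FrameSeq

end

namespace FrameSeq

section Minimality

variable {𝕜 H I : Type*} [RCLike 𝕜] [NormedAddCommGroup H] [InnerProductSpace 𝕜 H]

/-! If `ψ j` lay in the closed span of the others, dropping it would not change the closed span; so
exactness gives minimality, and Hilbert space duality then gives a biorthogonal `φ`. The lower bound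
makes `C` injective with closed range, so Riesz representation on that range solves `⟨g, x⟩ = ⟨C f,
C x⟩`, the weak form of `Γ f = g`. Biorthogonality says that `C (φ j)` is the unit vector `e_j`, and
`⟨e_j, C x⟩ = ⟨π ψ_j, x⟩` in Mathlib's convention, so `Γ (φ j) = π ψ_j`. Hence every biorthogonal
sequence is the canonical dual; since one exists, the canonical dual is biorthogonal. -/

theorem IsExactSeq.isMinimalSeq {ψ : I → H} (h : IsExactSeq 𝕜 ψ) : IsMinimalSeq 𝕜 ψ := by
  intro j hj
  refine h j (le_antisymm ?_ ?_)
  · refine Submodule.topologicalClosure_minimal _ (Submodule.span_le.2 ?_)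
      (Submodule.isClosed_topologicalClosure _)
    rintro _ ⟨i, rfl⟩
    by_cases hij : i = j
    · exact hij ▸ hj
    · exact Submodule.le_topologicalClosure _ (Submodule.subset_span ⟨i, hij, rfl⟩)
  · exact Submodule.topologicalClosure_mono (Submodule.span_mono (Set.image_subset_range _ _))

/-- A minimal sequence has a biorthogonal sequence. -/
theorem IsMinimalSeq.exists_isBiorthogonal [CompleteSpace H] {ψ : I → H}
    (h : IsMinimalSeq 𝕜 ψ) : ∃ φ : I → H, IsBiorthogonal 𝕜 ψ φ := by
  have key : ∀ j, ∃ v : H, inner 𝕜 v (ψ j) = 1 ∧ ∀ i, i ≠ j → inner 𝕜 v (ψ i) = 0 := by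
    intro j
    have hj := h j
    -- Since `Kᗮᗮ` is the closure of `K`, some `u ∈ Kᗮ` is not orthogonal to `ψ j`; rescaling it
    -- gives `φ j`.
    rw [← Submodule.orthogonal_orthogonal_eq_closure, Submodule.mem_orthogonal] at hj
    push Not at hj
    obtain ⟨u, hu, hne⟩ := hj
    refine ⟨(starRingEnd 𝕜 (inner 𝕜 u (ψ j))⁻¹) • u, ?_, fun i hi => ?_⟩
    · rw [inner_smul_left, RCLike.conj_conj, inv_mul_cancel₀ hne]
    · have hmem : ψ i ∈ Submodule.span 𝕜 (ψ '' {i | i ≠ j}) :=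
        Submodule.subset_span ⟨i, hi, rfl⟩
      rw [inner_smul_left, Submodule.inner_left_of_mem_orthogonal hmem hu, mul_zero]
  choose φ h1 h0 using key
  refine ⟨φ, fun i j => ?_⟩
  split_ifs with hij
  · exact hij ▸ h1 i
  · exact h0 j i hij

end Minimality

section Analysis

variable {𝕜 H I : Type*} [RCLike 𝕜] [NormedAddCommGroup H] [InnerProductSpace 𝕜 H]

theorem analysisOp_coe_apply (ψ : I → H) (f : (analysisOp 𝕜 ψ).domain) (i : I) :
    analysisOp 𝕜 ψ f i = inner 𝕜 (ψ i) (f : H) :=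
  rfl

theorem IsLowerFrameSeq.eq_zero {ψ : I → H} (h : IsLowerFrameSeq 𝕜 ψ) {f : H}
    (hf : ∀ i, inner 𝕜 (ψ i) f = 0) : f = 0 := by
  obtain ⟨A, hA, hb⟩ := h
  have hmem : f ∈ (analysisOp 𝕜 ψ).domain := by
    change Memℓp (fun i => inner 𝕜 (ψ i) f) 2
    simp only [hf]
    exact zero_memℓp
  have h0 : analysisOp 𝕜 ψ ⟨f, hmem⟩ = 0 := lp.ext (funext hf)
  have := hb ⟨f, hmem⟩
  rw [h0, norm_zero] at this
  exact norm_eq_zero.1 (le_antisymm (nonpos_of_mul_nonpos_right this (Real.sqrt_pos.2 hA))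
    (norm_nonneg f))

theorem IsBiorthogonal.analysisOp_eq [DecidableEq I] {ψ φ : I → H}
    (h : IsBiorthogonal 𝕜 ψ φ) (j : I) :
    ∃ hj : φ j ∈ (analysisOp 𝕜 ψ).domain,
      analysisOp 𝕜 ψ ⟨φ j, hj⟩ = lp.single 2 j (1 : 𝕜) := by
  have hcoe : (fun i => inner 𝕜 (ψ i) (φ j)) = (lp.single 2 j (1 : 𝕜) : lp (fun _ : I => 𝕜) 2) := by
    funext i
    rw [← inner_conj_symm, h i j, lp.single_apply]
    by_cases hij : i = j
    · subst hij; simp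
    · simp [hij]
  have hmem : φ j ∈ (analysisOp 𝕜 ψ).domain := by
    change Memℓp (fun i => inner 𝕜 (ψ i) (φ j)) 2
    rw [hcoe]
    exact lp.memℓp _
  exact ⟨hmem, lp.ext hcoe⟩

-- If `C f_n` converges, the lower bound makes `f_n` Cauchy. Its limit has the limiting
-- coefficients, and these being in `ℓ²` is exactly membership in the domain.
open Filter Topology in
theorem IsLowerFrameSeq.isClosed_range [CompleteSpace H] {ψ : I → H}
    (h : IsLowerFrameSeq 𝕜 ψ) :
    IsClosed (LinearMap.range (analysisOp 𝕜 ψ).toFun : Set (lp (fun _ : I => 𝕜) 2)) := by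
  obtain ⟨A, hA, hb⟩ := h
  refine isClosed_of_closure_subset fun y hy => ?_
  obtain ⟨u, hu, hlim⟩ := mem_closure_iff_seq_limit.1 hy
  choose f hf using hu
  replace hf : ∀ n, analysisOp 𝕜 ψ (f n) = u n := hf
  have hcauchy : CauchySeq fun n => (f n : H) := by
    rw [Metric.cauchySeq_iff]
    intro ε hε
    obtain ⟨N, hN⟩ := Metric.cauchySeq_iff.1 hlim.cauchySeq (√A * ε)
      (mul_pos (Real.sqrt_pos.2 hA) hε)
    refine ⟨N, fun m hm n hn => ?_⟩
    have h1 := hN m hm n hn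
    have h2 := hb (f m - f n)
    rw [LinearPMap.map_sub, hf, hf, ← dist_eq_norm] at h2
    rw [dist_eq_norm]
    exact lt_of_mul_lt_mul_left (h2.trans_lt h1) (Real.sqrt_nonneg A)
  obtain ⟨g, hg⟩ := cauchySeq_tendsto_of_complete hcauchy
  have hcoord : ∀ i, inner 𝕜 (ψ i) g = y i := by
    intro i
    have h1 : Tendsto (fun n => inner 𝕜 (ψ i) (f n : H)) atTop (𝓝 (inner 𝕜 (ψ i) g)) :=
      tendsto_const_nhds.inner hg
    have h2 : Tendsto (fun n => u n i) atTop (𝓝 (y i)) :=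
      ((continuous_apply i).comp lp.uniformContinuous_coe.continuous).continuousAt.tendsto.comp
        hlim
    refine tendsto_nhds_unique h1 (h2.congr fun n => ?_)
    rw [← hf n, analysisOp_coe_apply]
  have hmem : g ∈ (analysisOp 𝕜 ψ).domain := by
    change Memℓp (fun i => inner 𝕜 (ψ i) g) 2
    simp only [hcoord]
    exact lp.memℓp y
  exact ⟨⟨g, hmem⟩, lp.ext (funext hcoord)⟩

/-- Every vector is represented on the domain of the analysis operator `C` of a lower frame
sequence by the form `⟨C f, C h⟩`. -/
theorem IsLowerFrameSeq.exists_inner_analysisOp_eq [CompleteSpace H] {ψ : I → H}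
    (h : IsLowerFrameSeq 𝕜 ψ) (g : H) :
    ∃ f : (analysisOp 𝕜 ψ).domain, ∀ x : (analysisOp 𝕜 ψ).domain,
      inner 𝕜 g (x : H) = inner 𝕜 (analysisOp 𝕜 ψ f) (analysisOp 𝕜 ψ x) := by
  have hclosed := h.isClosed_range
  have hinj : Function.Injective (analysisOp 𝕜 ψ).toFun := by
    refine (injective_iff_map_eq_zero _).2 fun f hf => Subtype.ext (h.eq_zero fun i => ?_)
    exact congrFun (congrArg (fun y : lp (fun _ : I => 𝕜) 2 => (y : I → 𝕜)) hf) i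
  obtain ⟨A, hA, hb⟩ := h
  have : CompleteSpace (LinearMap.range (analysisOp 𝕜 ψ).toFun) := hclosed.completeSpace_coe
  let e := LinearEquiv.ofInjective (analysisOp 𝕜 ψ).toFun hinj
  -- The functional `y ↦ ⟨g, C⁻¹ y⟩`, bounded because `‖C⁻¹‖ ≤ 1/√A`. Its Riesz vector lies in the
  -- range, so it is some `C f`.
  let ℓ : StrongDual 𝕜 (LinearMap.range (analysisOp 𝕜 ψ).toFun) :=
    (innerSL 𝕜 g).comp (LinearMap.mkContinuous
      ((analysisOp 𝕜 ψ).domain.subtype ∘ₗ e.symm.toLinearMap) (√A)⁻¹ fun y => by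
        obtain ⟨x, rfl⟩ := e.surjective y
        rw [inv_mul_eq_div, le_div_iff₀ (Real.sqrt_pos.2 hA), mul_comm]
        simpa [e] using hb x)
  obtain ⟨f, hf⟩ := ((InnerProductSpace.toDual 𝕜 _).symm ℓ).2
  refine ⟨f, fun x => ?_⟩
  have hx : inner 𝕜 ((InnerProductSpace.toDual 𝕜 _).symm ℓ) (e x) = ℓ (e x) :=
    InnerProductSpace.toDual_symm_apply
  have hℓ : ℓ (e x) = inner 𝕜 g (x : H) := by simp [ℓ]
  rw [← hℓ, ← hx, Submodule.coe_inner, ← hf]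
  rfl

end Analysis

section FrameOperator

variable {𝕜 H I : Type*} [RCLike 𝕜] [NormedAddCommGroup H] [InnerProductSpace 𝕜 H]
  [CompleteSpace H]

theorem restrictedAnalysisOp_eq (ψ : I → H) (f : (restrictedAnalysisOp 𝕜 ψ).domain) :
    restrictedAnalysisOp 𝕜 ψ f = analysisOp 𝕜 ψ ⟨((f : domClosure 𝕜 ψ) : H),
      (mem_restrictedAnalysisOp_domain 𝕜 ψ f).1 f.2⟩ :=
  lp.ext (funext fun i => restrictedAnalysisOp_aux 𝕜 ψ f i)

/-- Transfers the results on `C` to `C^r`, where the domain is dense. -/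
theorem IsLowerFrameSeq.projSeq {ψ : I → H} (h : IsLowerFrameSeq 𝕜 ψ) :
    IsLowerFrameSeq 𝕜 (projSeq 𝕜 ψ) := by
  obtain ⟨A, hA, hb⟩ := h
  refine ⟨A, hA, fun f => ?_⟩
  exact (hb _).trans_eq (congrArg norm (restrictedAnalysisOp_eq ψ f).symm)

open scoped LinearPMap

/-- The weak form of the equation `Γ f = g`. -/
theorem genFrameOp_eq_of_inner {ψ : I → H} (f : (restrictedAnalysisOp 𝕜 ψ).domain)
    (g : domClosure 𝕜 ψ) (hfg : ∀ x : (restrictedAnalysisOp 𝕜 ψ).domain,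
      inner 𝕜 g (x : domClosure 𝕜 ψ) =
        inner 𝕜 (restrictedAnalysisOp 𝕜 ψ f) (restrictedAnalysisOp 𝕜 ψ x)) :
    ∃ hf : (f : domClosure 𝕜 ψ) ∈ (genFrameOp 𝕜 ψ).domain, genFrameOp 𝕜 ψ ⟨f, hf⟩ = g := by
  have hadj : restrictedAnalysisOp 𝕜 ψ f ∈ (restrictedAnalysisOp 𝕜 ψ)†.domain :=
    LinearPMap.mem_adjoint_domain_of_exists _ ⟨g, hfg⟩
  refine ⟨(mem_opComp_domain _ _ _).2 ⟨f.2, hadj⟩, ?_⟩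
  -- Density of the domain makes `g` the only candidate for the adjoint's value.
  exact LinearPMap.adjoint_apply_eq (dense_restrictedAnalysisOp_domain 𝕜 ψ)
    ⟨restrictedAnalysisOp 𝕜 ψ f, hadj⟩ hfg

theorem inner_genFrameOp_self {ψ : I → H} (f : (genFrameOp 𝕜 ψ).domain) :
    ∃ hf : (f : domClosure 𝕜 ψ) ∈ (restrictedAnalysisOp 𝕜 ψ).domain,
      inner 𝕜 (genFrameOp 𝕜 ψ f) (f : domClosure 𝕜 ψ) =
        inner 𝕜 (restrictedAnalysisOp 𝕜 ψ ⟨f, hf⟩) (restrictedAnalysisOp 𝕜 ψ ⟨f, hf⟩) := by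
  obtain ⟨hf, hadj⟩ := (mem_opComp_domain _ _ _).1 f.2
  exact ⟨hf, LinearPMap.adjoint_isFormalAdjoint (dense_restrictedAnalysisOp_domain 𝕜 ψ)
    ⟨restrictedAnalysisOp 𝕜 ψ ⟨f, hf⟩, hadj⟩ ⟨f, hf⟩⟩

/-- If `Γ f = 0` then `‖C^r f‖² = ⟨Γ f, f⟩ = 0`. -/
theorem IsLowerFrameSeq.genFrameOp_injective {ψ : I → H} (h : IsLowerFrameSeq 𝕜 ψ) :
    Function.Injective (genFrameOp 𝕜 ψ).toFun := by
  refine (injective_iff_map_eq_zero _).2 fun f hf => Subtype.ext (h.projSeq.eq_zero fun i => ?_)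
  obtain ⟨hmem, heq⟩ := inner_genFrameOp_self f
  rw [show genFrameOp 𝕜 ψ f = 0 from hf, inner_zero_left] at heq
  exact congrFun (congrArg (fun y : lp (fun _ : I => 𝕜) 2 => (y : I → 𝕜))
    (inner_self_eq_zero.1 heq.symm)) i

theorem IsLowerFrameSeq.genFrameOp_bijective {ψ : I → H} (h : IsLowerFrameSeq 𝕜 ψ) :
    Function.Bijective (genFrameOp 𝕜 ψ).toFun := by
  refine ⟨h.genFrameOp_injective, fun g => ?_⟩
  obtain ⟨f, hf⟩ := h.projSeq.exists_inner_analysisOp_eq g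
  obtain ⟨hmem, heq⟩ := genFrameOp_eq_of_inner f g hf
  exact ⟨⟨f, hmem⟩, heq⟩

/-- The canonical dual of a lower frame sequence is its only possible biorthogonal sequence. -/
theorem IsLowerFrameSeq.canonicalDual_eq {ψ φ : I → H} (h : IsLowerFrameSeq 𝕜 ψ)
    (hφ : IsBiorthogonal 𝕜 ψ φ) : canonicalDual 𝕜 ψ = φ := by
  classical
  funext j
  obtain ⟨hj, heq⟩ := hφ.analysisOp_eq j
  have hj' : (⟨φ j, Submodule.le_topologicalClosure _ hj⟩ : domClosure 𝕜 ψ) ∈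
      (restrictedAnalysisOp 𝕜 ψ).domain := (mem_restrictedAnalysisOp_domain 𝕜 ψ _).2 hj
  -- Both sides of the weak equation are the `j`-th coordinate of `C^r x`.
  obtain ⟨hmem, hΓ⟩ := genFrameOp_eq_of_inner ⟨_, hj'⟩ (FrameSeq.projSeq 𝕜 ψ j) fun x => by
    rw [restrictedAnalysisOp_eq ψ ⟨_, hj'⟩, heq, lp.inner_single_left]
    simp only [RCLike.inner_apply, map_one, mul_one]
    rfl
  have hinv : genFrameOpInv 𝕜 ψ (FrameSeq.projSeq 𝕜 ψ j) = ⟨_, hmem⟩ :=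
    (congrArg _ hΓ.symm).trans (Function.leftInverse_invFun h.genFrameOp_injective _)
  rw [canonicalDual, hinv]

end FrameOperator

end FrameSeq

theorem mainTheorem7 {𝕜 H I : Type*} [RCLike 𝕜] [NormedAddCommGroup H] [InnerProductSpace 𝕜 H]
    [CompleteSpace H] [Countable I] (ψ : I → H)
    (hlower : FrameSeq.IsLowerFrameSeq 𝕜 ψ) (hexact : FrameSeq.IsExactSeq 𝕜 ψ) :
    Function.Bijective (FrameSeq.genFrameOp 𝕜 ψ).toFun ∧
    FrameSeq.IsBiorthogonal 𝕜 ψ (FrameSeq.canonicalDual 𝕜 ψ) ∧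
    (∀ φ : I → H, FrameSeq.IsBiorthogonal 𝕜 ψ φ → φ = FrameSeq.canonicalDual 𝕜 ψ) ∧
    FrameSeq.IsMinimalSeq 𝕜 ψ := by
  obtain ⟨φ, hφ⟩ := hexact.isMinimalSeq.exists_isBiorthogonal
  refine ⟨hlower.genFrameOp_bijective, ?_, fun φ' hφ' => (hlower.canonicalDual_eq hφ').symm,
    hexact.isMinimalSeq⟩
  rw [hlower.canonicalDual_eq hφ]
  exact hφ
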